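/- Let $N\in\mathbb{N}$, $T>0$, $P:\mathbb{R}^N\to\mathbb{R}^N$ and $\bm{x}_0\in\mathbb{R}^N$, let $\bm{x}:[0,T]\to\mathbb{R}^N$ be a solution of $\dot{\bm{x}}=P(\bm{x})$, $\bm{x}(0)=\bm{x}_0$ (one-sided derivatives at the end points), and let $\mathcal{X}(\bm{x}_0)=\{\bm{x}(t):0\le t\le T\}$ be its orbit. Assume that $P$ is continuous on $\mathcal{X}(\bm{x}_0)$, that $\mathcal{X}(\bm{x}_0)$ is a simple curve without self-intersections (i.e. $t\mapsto\bm{x}(t)$ is injective on $[0,T]$; in particular the curve is not closed), and that it contains no equilibrium point (i.e. $P(\bm{p})\neq\bm{0}$ for every $\bm{p}\in\mathcal{X}(\bm{x}_0)$). Then there is a coordinate system of $\mathbb{R}^N$, isotopic to the standard one, in which the orbit is a straight segment in direction $(1,\dots,1)$ and the dynamics along the orbit is strictly monotone in each coordinate. Precisely, there are a real number $c>0$ and a continuous map $\mathcal{H}:\mathbb{R}^N\times[0,1]\to\mathbb{R}^N$ such that 1. $\mathcal{H}_s=\mathcal{H}(\cdot,s)$ is a homeomorphism of $\mathbb{R}^N$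 onto itself for every $s\in[0,1]$, and $\mathcal{H}_0=\mathrm{Id}$; 2. $\mathcal{H}_1(\mathcal{X}(\bm{x}_0))=\{\sigma\,(1,\dots,1): 0\le\sigma\le c\}$; 3. in the coordinates $\bm{y}=\mathcal{H}_1(\bm{x})$, each function $t\mapsto y_i(t)=\big(\mathcal{H}_1(\bm{x}(t))\big)_i$, $i=1,\dots,N$, is strictly monotone (strictly increasing or strictly decreasing) on $[0,T]$; 4. if $N\ge 2$, then moreover $\mathcal{H}_1(\bm{x}_0)=\bm{0}$ and every $y_i$ is strictly increasing on $[0,T]$. -/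

import Mathlib

namespace OrbitIsotopy

/-- The phase space `ℝ^N`, with its Euclidean norm. -/
abbrev Phase (N : ℕ) : Type := EuclideanSpace ℝ (Fin N)

/-- `x` solves `x' = P(x)`, `x(0) = x₀` on the time interval `[0, T]`
(with one-sided derivatives at the two end points). -/
structure IsSolution {N : ℕ} (P : Phase N → Phase N) (x₀ : Phase N) (T : ℝ)
    (x : ℝ → Phase N) : Prop where
  initial : x 0 = x₀
  hasDeriv : ∀ t ∈ Set.Icc (0 : ℝ) T, HasDerivWithinAt x (P (x t)) (Set.Icc (0 : ℝ) T) t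

/-- The orbit: the curve traced in phase space by the solution on `[0, T]`. -/
def orbit {N : ℕ} (T : ℝ) (x : ℝ → Phase N) : Set (Phase N) :=
  x '' Set.Icc (0 : ℝ) T

/-- `p` is an equilibrium point of `x' = P(x)`. -/
def IsEquilibrium {N : ℕ} (P : Phase N → Phase N) (p : Phase N) : Prop :=
  P p = 0

/-- The curve traced on `[0, T]` is simple: no self-intersections, and in particular not closed. -/
def IsSimpleCurve {N : ℕ} (T : ℝ) (x : ℝ → Phase N) : Prop :=
  Set.InjOn x (Set.Icc (0 : ℝ) T)

/-- An ambient isotopy of `ℝ^N` starting at the identity: a jointly continuous family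
`H (·, s)`, `s ∈ [0, 1]`, of homeomorphisms of `ℝ^N` onto itself with `H (·, 0) = id`. -/
structure IsAmbientIsotopy {N : ℕ} (H : Phase N × unitInterval → Phase N) : Prop where
  continuous : Continuous H
  homeomorph : ∀ s : unitInterval, IsHomeomorph (fun p : Phase N => H (p, s))
  start : ∀ p : Phase N, H (p, 0) = p

/-- The ambient isotopy `H` carries the curve `γ` onto the curve `ρ`. -/
def Carries {N : ℕ} (H : Phase N × unitInterval → Phase N) (γ ρ : Set (Phase N)) : Prop :=
  (fun p : Phase N => H (p, 1)) '' γ = ρ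

/-- The straight segment `{ s (1, 1, …, 1) : 0 ≤ s ≤ c }` (for `0 ≤ c`). -/
def diagonalSegment (N : ℕ) (c : ℝ) : Set (Phase N) :=
  segment ℝ 0 (WithLp.toLp 2 (fun _ : Fin N => c))

end OrbitIsotopy

open Set Filter Topology unitInterval
open scoped NNReal

namespace OrbitIsotopy

variable {N : ℕ}

/-! An arc can be shortened from its free end by an ambient isotopy, so knotting is no obstruction.
Since `P` is continuous and nonzero on the orbit, a functional `φ` positive on the velocity at a
point makes the nearby arc a graph over `φ`, and a shear straightens it (`exists_straightening`). In
such coordinates a small push slides the endpoint along the line without touching the earlier arc;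
injectivity and compactness keep that earlier arc at a distance (`arcTransfer_of_straight`).
Connectedness of `(0, T]` chains these slides (`arcTransfer_of_isSolution`), shrinking the orbit to
a short initial arc, which is straightened and moved linearly to the diagonal. Monotonicity then
follows from continuity and injectivity. -/

/-- `h` is the final stage of an ambient isotopy. -/
def IsotopicToId (h : Phase N → Phase N) : Prop :=
  ∃ H : Phase N × unitInterval → Phase N, IsAmbientIsotopy H ∧ ∀ p, H (p, 1) = h p

theorem IsotopicToId.isHomeomorph {h : Phase N → Phase N} (hh : IsotopicToId h) :
    IsHomeomorph h := by
  obtain ⟨H, hH, h1⟩ := hh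
  have := hH.homeomorph 1
  simpa only [h1] using this

theorem IsotopicToId.comp {g h : Phase N → Phase N} (hg : IsotopicToId g)
    (hh : IsotopicToId h) : IsotopicToId (g ∘ h) := by
  obtain ⟨G, hG, hG1⟩ := hg
  obtain ⟨H, hH, hH1⟩ := hh
  refine ⟨fun z => G (H z, z.2), ⟨hG.continuous.comp (hH.continuous.prodMk continuous_snd),
    fun s => (hG.homeomorph s).comp (hH.homeomorph s), fun p => ?_⟩, fun p => ?_⟩
  · simp only [hH.start, hG.start]
  · simp only [hH1, hG1, Function.comp_apply]

theorem IsotopicToId.conj {h : Phase N → Phase N} (hh : IsotopicToId h)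
    (S : Phase N ≃ₜ Phase N) : IsotopicToId (fun p => S.symm (h (S p))) := by
  obtain ⟨H, hH, hH1⟩ := hh
  refine ⟨fun z => S.symm (H (S z.1, z.2)), ⟨?_, fun s => ?_, fun p => ?_⟩, fun p => ?_⟩
  · exact S.symm.continuous.comp
      (hH.continuous.comp ((S.continuous.comp continuous_fst).prodMk continuous_snd))
  · exact S.symm.isHomeomorph.comp ((hH.homeomorph s).comp S.isHomeomorph)
  · simp only [hH.start, S.symm_apply_apply]
  · simp only [hH1]

/-! ### Elementary isotopies: shears and small pushes -/

/-- The shear `p ↦ p + f (φ p)` along the level sets of the linear functional `φ`. -/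
def shear (φ : Phase N →L[ℝ] ℝ) (f : ℝ → Phase N) (hf : Continuous f) (hφ : ∀ a, φ (f a) = 0) :
    Phase N ≃ₜ Phase N where
  toFun p := p + f (φ p)
  invFun p := p - f (φ p)
  left_inv p := by simp [hφ]
  right_inv p := by simp [hφ]
  continuous_toFun := by fun_prop
  continuous_invFun := by fun_prop

theorem isotopicToId_shear (φ : Phase N →L[ℝ] ℝ) (f : ℝ → Phase N) (hf : Continuous f)
    (hφ : ∀ a, φ (f a) = 0) : IsotopicToId (shear φ f hf hφ) := by
  refine ⟨fun z => z.1 + (z.2 : ℝ) • f (φ z.1), ⟨by fun_prop, fun s => ?_, fun p => ?_⟩,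
    fun p => ?_⟩
  · exact (shear φ (fun a => (s : ℝ) • f a) (by fun_prop) (fun a => by simp [hφ])).isHomeomorph
  · simp
  · simp [shear]

theorem isotopicToId_add_const (b : Phase N) : IsotopicToId (fun p => p + b) :=
  isotopicToId_shear 0 (fun _ => b) continuous_const (fun _ => rfl)

theorem isHomeomorph_id_add_of_lipschitzWith {w : Phase N → Phase N} {K : ℝ≥0}
    (hw : LipschitzWith K w) (hK : K < 1) : IsHomeomorph (fun p => p + w p) := by
  have hf : ApproximatesLinearOn (fun p => p + w p)
      ((ContinuousLinearEquiv.refl ℝ (Phase N) : Phase N ≃L[ℝ] Phase N) :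
        Phase N →L[ℝ] Phase N) univ K := by
    intro p _ q _
    have := hw.norm_sub_le p q
    simpa [add_sub_add_comm] using this
  refine (hf.toHomeomorph _ ?_).isHomeomorph
  rcases subsingleton_or_nontrivial (Phase N) with h | h
  · exact Or.inl h
  · right
    have : ‖((ContinuousLinearEquiv.refl ℝ (Phase N)).symm : Phase N →L[ℝ] Phase N)‖₊ = 1 := by
      ext; exact ContinuousLinearMap.norm_id
    rw [this]; simpa using hK

theorem isotopicToId_id_add_of_lipschitzWith {w : Phase N → Phase N} {K : ℝ≥0}
    (hw : LipschitzWith K w) (hK : K < 1) : IsotopicToId (fun p => p + w p) := by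
  have hc := hw.continuous
  refine ⟨fun z => z.1 + (z.2 : ℝ) • w z.1, ⟨by fun_prop, fun s => ?_, fun p => ?_⟩, fun p => ?_⟩
  · refine isHomeomorph_id_add_of_lipschitzWith (w := fun p => (s : ℝ) • w p) (K := K) ?_ hK
    refine LipschitzWith.of_dist_le_mul fun p q => ?_
    rw [dist_smul₀, Real.norm_of_nonneg s.2.1]
    exact (mul_le_of_le_one_left dist_nonneg s.2.2).trans (hw.dist_le_mul p q)
  · simp
  · simp

/-- A point can be pushed by a short vector by an isotopy with support in a ball. -/
theorem exists_push (q v : Phase N) {ρ : ℝ} (hv : ‖v‖ < ρ) :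
    ∃ b : Phase N → ℝ, Continuous b ∧ b q = 1 ∧ (∀ p, ρ ≤ ‖p - q‖ → b p = 0) ∧
      IsotopicToId (fun p => p + b p • v) := by
  have hρ : 0 < ρ := (norm_nonneg v).trans_lt hv
  -- The tent function is `1/ρ`-Lipschitz, so the displacement has Lipschitz constant `‖v‖ / ρ < 1`.
  refine ⟨fun p => max (1 - ‖p - q‖ / ρ) 0, by fun_prop, by simp, fun p hp => ?_, ?_⟩
  · exact max_eq_right (sub_nonpos.2 ((one_le_div hρ).2 hp))
  · refine isotopicToId_id_add_of_lipschitzWith (K := (‖v‖ / ρ).toNNReal) ?_ ?_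
    · refine LipschitzWith.of_dist_le_mul fun p p' => ?_
      rw [dist_eq_norm, ← sub_smul, norm_smul, Real.norm_eq_abs,
        Real.coe_toNNReal _ (by positivity)]
      have h1 : |max (1 - ‖p - q‖ / ρ) 0 - max (1 - ‖p' - q‖ / ρ) 0| ≤ dist p p' / ρ := by
        refine (abs_max_sub_max_le_abs _ _ _).trans ?_
        rw [sub_sub_sub_cancel_left, ← sub_div, abs_div, abs_of_pos hρ, dist_comm, dist_eq_norm]
        gcongr
        simpa using abs_norm_sub_norm_le (p' - q) (p - q)
      calc _ ≤ dist p p' / ρ * ‖v‖ := by gcongr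
        _ = _ := by ring
    · rw [Real.toNNReal_lt_one]
      exact (div_lt_one hρ).2 hv

/-! ### Sliding the endpoint of an arc -/

/-- Some isotopy of the space carries the arc `x [0, s]` onto the arc `x [0, t]`, and fixes `x 0`. -/
def ArcTransfer (x : ℝ → Phase N) (s t : ℝ) : Prop :=
  ∃ h : Phase N → Phase N, IsotopicToId h ∧ h (x 0) = x 0 ∧ h '' (x '' Icc 0 s) = x '' Icc 0 t

theorem ArcTransfer.trans {x : ℝ → Phase N} {r s t : ℝ} (h₁ : ArcTransfer x r s)
    (h₂ : ArcTransfer x s t) : ArcTransfer x r t := by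
  obtain ⟨g, hg, hg0, hgx⟩ := h₁
  obtain ⟨h, hh, hh0, hhx⟩ := h₂
  exact ⟨h ∘ g, hh.comp hg, by simp [hg0, hh0], by rw [image_comp, hgx, hhx]⟩

theorem image_image_Icc_of_straight {x : ℝ → Phase N} {S : Phase N → Phase N} {u : Phase N}
    {m : ℝ → ℝ} {a t : ℝ} (hat : a ≤ t) (hmc : ContinuousOn m (Icc a t))
    (hm : StrictMonoOn m (Icc a t)) (hS : ∀ s ∈ Icc a t, S (x s) = m s • u) :
    S '' (x '' Icc a t) = (fun r : ℝ => r • u) '' Icc (m a) (m t) := by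
  rw [← hmc.image_Icc_of_monotoneOn hat hm.monotoneOn, image_image, image_image]
  exact image_congr hS

/-- The push taking `S (x s)` to `S (x t)` fixes the arc up to time `a`, which lies outside its
support, and maps the line `ℝ u` to itself. -/
theorem arcTransfer_of_straight {x : ℝ → Phase N} (S : Phase N ≃ₜ Phase N) {u : Phase N}
    (hu : u ≠ 0) {m : ℝ → ℝ} {a d ρ s t : ℝ} (ha : 0 ≤ a)
    (hmc : ContinuousOn m (Icc a d)) (hm : StrictMonoOn m (Icc a d))
    (hS : ∀ r ∈ Icc a d, S (x r) = m r • u) (hs : s ∈ Ioc a d) (ht : t ∈ Ioc a d)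
    (hfar : ∀ r ∈ Icc 0 a, ρ ≤ ‖S (x r) - S (x s)‖) (hnear : ‖S (x t) - S (x s)‖ < ρ) :
    ArcTransfer x s t := by
  obtain ⟨b, hbc, hb1, hb0, hb⟩ := exists_push (S (x s)) _ hnear
  set h : Phase N → Phase N := fun p => p + b p • (S (x t) - S (x s)) with hh
  have had : a ∈ Icc a d := ⟨le_rfl, hs.1.le.trans hs.2⟩
  have hfix : ∀ r ∈ Icc 0 a, h (S (x r)) = S (x r) := fun r hr => by
    simp [hh, hb0 _ (hfar r hr)]
  set k : ℝ → ℝ := fun r => r + b (r • u) * (m t - m s) with hk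
  have hhk : ∀ r : ℝ, h (r • u) = k r • u := fun r => by
    simp only [hh, hk, hS s (Ioc_subset_Icc_self hs), hS t (Ioc_subset_Icc_self ht)]
    module
  have hkinj : Function.Injective k := fun r r' hrr => by
    have : h (r • u) = h (r' • u) := by rw [hhk, hhk, hrr]
    exact smul_left_injective ℝ hu (hb.isHomeomorph.injective this)
  have hka : k (m a) = m a := by
    have := hfix a ⟨ha, le_rfl⟩
    rw [hS a had, hhk] at this
    exact smul_left_injective ℝ hu this
  have hks : k (m s) = m t := by
    simp only [hk, ← hS s (Ioc_subset_Icc_self hs), hb1]; ring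
  have hkc : Continuous k := by fun_prop
  have hmas : m a < m s := hm had (Ioc_subset_Icc_self hs) hs.1
  have hmat : m a < m t := hm had (Ioc_subset_Icc_self ht) ht.1
  -- A continuous injection on an interval is monotone; the endpoint values decide the direction.
  have hkm : StrictMonoOn k (Icc (m a) (m s)) :=
    ContinuousOn.strictMonoOn_of_injOn_Icc hmas.le (by rw [hka, hks]; exact hmat.le)
      hkc.continuousOn hkinj.injOn
  have hsub : ∀ r ∈ Ioc a d, Icc a r ⊆ Icc a d := fun r hr => Icc_subset_Icc_right hr.2
  have hseg : h '' (S '' (x '' Icc a s)) = S '' (x '' Icc a t) := by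
    rw [image_image_Icc_of_straight hs.1.le (hmc.mono (hsub s hs)) (hm.mono (hsub s hs))
        (fun r hr => hS r (hsub s hs hr)),
      image_image_Icc_of_straight ht.1.le (hmc.mono (hsub t ht)) (hm.mono (hsub t ht))
        (fun r hr => hS r (hsub t ht hr)), image_image]
    simp only [hhk]
    rw [← hka, ← hks, ← hkc.continuousOn.image_Icc_of_monotoneOn hmas.le hkm.monotoneOn,
      image_image, hka]
  have hpre : h '' (S '' (x '' Icc 0 a)) = S '' (x '' Icc 0 a) := by
    rw [image_image, image_image, image_image]
    exact image_congr hfix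
  refine ⟨_, hb.conj S, ?_, ?_⟩
  · have := hfix 0 ⟨le_rfl, ha⟩
    exact (congrArg S.symm this).trans (S.symm_apply_apply _)
  · have : ∀ A : Set (Phase N), (fun p => S.symm (h (S p))) '' A = S.symm '' (h '' (S '' A)) :=
      fun A => by rw [image_image, image_image]
    refine (this _).trans ?_
    rw [← Icc_union_Icc_eq_Icc ha hs.1.le, ← Icc_union_Icc_eq_Icc ha ht.1.le, image_union,
      image_union, image_union, image_union, hseg, hpre, ← image_union, ← image_union,
      image_image]
    simp [image_union]

/-- Near each of its points, a simple regular arc is straightened by a shear. -/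
theorem exists_straightening {P : Phase N → Phase N} {x₀ : Phase N} {T : ℝ}
    {x : ℝ → Phase N} (hx : IsSolution P x₀ T x) (hP : ContinuousOn P (orbit T x))
    (hequil : ∀ p ∈ orbit T x, ¬ IsEquilibrium P p) {t₀ : ℝ} (ht₀ : t₀ ∈ Icc 0 T) :
    ∃ (S : Phase N ≃ₜ Phase N) (u : Phase N) (m : ℝ → ℝ) (δ : ℝ), IsotopicToId S ∧ u ≠ 0 ∧
      0 < δ ∧ ContinuousOn m (Icc 0 T) ∧ StrictMonoOn m (Icc (t₀ - δ) (t₀ + δ) ∩ Icc 0 T) ∧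
      ∀ t ∈ Icc (t₀ - δ) (t₀ + δ) ∩ Icc 0 T, S (x t) = m t • u := by
  have hxc : ContinuousOn x (Icc 0 T) := fun t ht => (hx.hasDeriv t ht).continuousWithinAt
  have hu : P (x t₀) ≠ 0 := hequil _ (mem_image_of_mem x ht₀)
  obtain ⟨φ, hφ⟩ := SeparatingDual.exists_eq_one (R := ℝ) hu
  have hder : ContinuousOn (fun t => φ (P (x t))) (Icc 0 T) :=
    φ.continuous.comp_continuousOn (hP.comp hxc (mapsTo_image x _))
  have hpos : ∀ᶠ t in 𝓝[Icc 0 T] t₀, 0 < φ (P (x t)) :=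
    (hder t₀ ht₀).eventually (lt_mem_nhds (by simp [hφ]))
  obtain ⟨δ, hδ, hball⟩ := (nhdsWithin_hasBasis Metric.nhds_basis_closedBall _).eventually_iff.1 hpos
  rw [Real.closedBall_eq_Icc] at hball
  set J := Icc (t₀ - δ) (t₀ + δ) ∩ Icc 0 T with hJ
  have hJT : J ⊆ Icc 0 T := inter_subset_right
  have hmc : ContinuousOn (fun t => φ (x t)) (Icc 0 T) := φ.continuous.comp_continuousOn hxc
  have hm : StrictMonoOn (fun t => φ (x t)) J := by
    refine strictMonoOn_of_hasDerivWithinAt_pos (f' := fun t => φ (P (x t)))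
      ((convex_Icc _ _).inter (convex_Icc _ _)) (hmc.mono hJT) (fun t ht => ?_)
      (fun t ht => hball (interior_subset ht))
    exact (φ.hasFDerivAt.comp_hasDerivWithinAt t (hx.hasDeriv t (hJT (interior_subset ht)))).mono
      (interior_subset.trans hJT)
  have hJc : IsCompact J := isCompact_Icc.inter isCompact_Icc
  have : CompactSpace J := isCompact_iff_compactSpace.1 hJc
  have hemb : IsClosedEmbedding (fun t : J => φ (x t)) :=
    Continuous.isClosedEmbedding (hmc.mono hJT).domRestrict
      (fun s t hst => Subtype.ext (hm.injOn s.2 t.2 hst))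
  -- Tietze: the local inverse `φ (x t) ↦ x t` extends from a compact set to all of `ℝ`.
  obtain ⟨F, hF⟩ := ContinuousMap.exists_extension' hemb
    ⟨fun t : J => x t, (hxc.mono hJT).domRestrict⟩
  have hF' : ∀ t ∈ J, F (φ (x t)) = x t := fun t ht => congrFun hF ⟨t, ht⟩
  refine ⟨shear φ (fun a => φ (F a) • P (x t₀) - F a) (by fun_prop) (fun a => by simp [hφ]),
    P (x t₀), fun t => φ (x t), δ, isotopicToId_shear _ _ _ _, hu, hδ, hmc, hm, fun t ht => ?_⟩
  change x t + (φ (F (φ (x t))) • P (x t₀) - F (φ (x t))) = _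
  rw [hF' t ht]
  abel

theorem arcTransfer_of_isSolution {P : Phase N → Phase N} {x₀ : Phase N} {T : ℝ}
    {x : ℝ → Phase N} (hx : IsSolution P x₀ T x) (hP : ContinuousOn P (orbit T x))
    (hsimple : IsSimpleCurve T x) (hequil : ∀ p ∈ orbit T x, ¬ IsEquilibrium P p)
    {s t : ℝ} (hs : s ∈ Ioc 0 T) (ht : t ∈ Ioc 0 T) : ArcTransfer x s t := by
  have hxc : ContinuousOn x (Icc 0 T) := fun t ht => (hx.hasDeriv t ht).continuousWithinAt
  -- A transitive relation that holds both ways between each point and its neighbours holds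
  -- throughout a connected set.
  refine isPreconnected_Ioc.induction₂' (ArcTransfer x) (fun t₀ ht₀ => ?_)
    (fun _ _ _ _ _ _ => ArcTransfer.trans) hs ht
  obtain ⟨S, u, m, δ, -, hu, hδ, hmc, hm, hSx⟩ :=
    exists_straightening hx hP hequil (Ioc_subset_Icc_self ht₀)
  set a := max 0 (t₀ - δ) with ha
  set d := min (t₀ + δ) T with hd
  have hsub : Icc a d = Icc (t₀ - δ) (t₀ + δ) ∩ Icc 0 T := by
    rw [Icc_inter_Icc, ha, hd, max_comm]
  rw [← hsub] at hm hSx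
  have hat : a < t₀ := max_lt ht₀.1 (by linarith)
  have htd : t₀ ≤ d := le_min (by linarith) ht₀.2
  have haT : Icc 0 a ⊆ Icc 0 T := Icc_subset_Icc_right (hat.le.trans ht₀.2)
  have hSxc : ContinuousOn (fun r => S (x r)) (Icc 0 T) := S.continuous.comp_continuousOn hxc
  have hK : IsCompact ((fun r => S (x r)) '' Icc 0 a) :=
    isCompact_Icc.image_of_continuousOn (hSxc.mono haT)
  have hnot : S (x t₀) ∈ ((fun r => S (x r)) '' Icc 0 a)ᶜ := by
    rintro ⟨r, hr, hrt⟩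
    have := hsimple (haT hr) (Ioc_subset_Icc_self ht₀) (S.injective hrt)
    exact absurd hr.2 (by rw [this]; exact not_le.2 hat)
  obtain ⟨ε, hε, hball⟩ := Metric.isOpen_iff.1 hK.isClosed.isOpen_compl _ hnot
  have hfar : ∀ r ∈ Icc 0 a, ε ≤ ‖S (x r) - S (x t₀)‖ := fun r hr => by
    by_contra! hlt
    exact hball (by rwa [Metric.mem_ball, dist_eq_norm]) (mem_image_of_mem _ hr)
  have h1 : ∀ᶠ r in 𝓝[Ioc 0 T] t₀, dist (S (x r)) (S (x t₀)) < ε / 2 :=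
    ((hSxc t₀ (Ioc_subset_Icc_self ht₀)).mono Ioc_subset_Icc_self).eventually
      (Metric.ball_mem_nhds _ (half_pos hε))
  have h2 : ∀ᶠ r in 𝓝[Ioc 0 T] t₀, r ∈ Ioo a (t₀ + δ) :=
    mem_nhdsWithin_of_mem_nhds (Ioo_mem_nhds hat (by linarith))
  filter_upwards [h1, h2, self_mem_nhdsWithin] with r hr1 hr2 hrT
  have hrd : r ∈ Ioc a d := ⟨hr2.1, le_min hr2.2.le hrT.2⟩
  have hmcd : ContinuousOn m (Icc a d) := hmc.mono (hsub.trans_subset inter_subset_right)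
  rw [dist_eq_norm] at hr1
  constructor
  · exact arcTransfer_of_straight S hu (le_max_left _ _) hmcd hm hSx ⟨hat, htd⟩ hrd hfar
      (hr1.trans (half_lt_self hε))
  -- The reverse push is centred at `S (x r)`, within `ε / 2` of `S (x t₀)`, so the earlier arc is
  -- still at least `ε / 2` away.
  · refine arcTransfer_of_straight S hu (le_max_left _ _) hmcd hm hSx hrd ⟨hat, htd⟩ (ρ := ε / 2)
      (fun q hq => ?_) (by rwa [norm_sub_rev])
    have := norm_sub_le_norm_sub_add_norm_sub (S (x q)) (S (x r)) (S (x t₀))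
    linarith [hfar q hq]

/-! ### From a segment to the diagonal -/

/-- A linear isotopy carrying the line `ℝ u` to `ℝ w`. -/
theorem exists_transvection {φ : Phase N →L[ℝ] ℝ} {u w : Phase N} (hu : φ u = 1) (hw : φ w = 1) :
    ∃ h : Phase N → Phase N, IsotopicToId h ∧ ∀ a : ℝ, h (a • u) = a • w := by
  refine ⟨_, isotopicToId_shear φ (fun a => a • (w - u)) (by fun_prop) (fun a => by simp [hu, hw]),
    fun a => ?_⟩
  simp only [shear, Homeomorph.homeomorph_mk_coe, Equiv.coe_fn_mk, map_smul, hu]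
  module

/-- The vector `(1, …, 1)`. -/
def ones (N : ℕ) : Phase N := WithLp.toLp 2 (fun _ => 1)

theorem diagonalSegment_eq_image (N : ℕ) {c : ℝ} (hc : 0 < c) :
    diagonalSegment N c = (fun a : ℝ => a • ones N) '' Icc 0 c := by
  have : (WithLp.toLp 2 (fun _ : Fin N => c) : Phase N) = c • ones N := by
    ext i; simp [ones]
  rw [diagonalSegment, this, segment_eq_image]
  ext p
  constructor
  · rintro ⟨θ, hθ, rfl⟩
    exact ⟨θ * c, ⟨mul_nonneg hθ.1 hc.le, mul_le_of_le_one_left hc.le hθ.2⟩, by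
      simp [mul_smul]⟩
  · rintro ⟨a, ha, rfl⟩
    exact ⟨a / c, ⟨div_nonneg ha.1 hc.le, (div_le_one hc).2 ha.2⟩, by
      simp [smul_smul, div_mul_cancel₀ _ hc.ne']⟩

/-- The intermediate vector `e` shares coordinate `i` with `ones N` and coordinate `j` with `-ones
N`, so two transvections suffice; this needs two distinct coordinates. -/
theorem exists_flip (hN : 2 ≤ N) :
    ∃ h : Phase N → Phase N, IsotopicToId h ∧ ∀ a : ℝ, h (a • ones N) = a • (-ones N) := by
  let i : Fin N := ⟨0, by omega⟩
  let j : Fin N := ⟨1, by omega⟩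
  have hij : i ≠ j := by simp [i, j]
  let e : Phase N := ones N - EuclideanSpace.single j 2
  obtain ⟨g, hg, hg'⟩ := exists_transvection (φ := EuclideanSpace.proj i) (u := ones N) (w := e)
    (by simp [ones]) (by simp [e, ones, hij])
  obtain ⟨h, hh, hh'⟩ := exists_transvection (φ := -EuclideanSpace.proj j) (u := e)
    (w := -ones N) (by simp [e, ones]; norm_num) (by simp [ones])
  exact ⟨h ∘ g, hh.comp hg, fun a => by simp [hg', hh']⟩

theorem image_smul_Icc_eq {w : Phase N} {c l : ℝ} (hc : 0 < c) :
    (fun a : ℝ => a • (c • w)) '' Icc 0 l = (fun a : ℝ => a • w) '' Icc 0 (l * c) := by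
  have : Icc 0 (l * c) = (fun a : ℝ => a * c) '' Icc 0 l := by
    rw [image_mul_right_Icc' _ _ hc, zero_mul]
  rw [this, image_image]
  simp only [smul_smul]

/-- Every segment issuing from the origin is carried to a diagonal segment by an isotopy. -/
theorem exists_segment_to_diagonal (hN : N ≠ 0) {u : Phase N} (hu : u ≠ 0) {l : ℝ} (hl : 0 < l) :
    ∃ (h : Phase N → Phase N) (c : ℝ), IsotopicToId h ∧ 0 < c ∧
      h '' ((fun a : ℝ => a • u) '' Icc 0 l) = diagonalSegment N c ∧ (2 ≤ N → h 0 = 0) := by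
  have h1 : ones N ≠ 0 := fun h => by
    have := congrArg (fun p : Phase N => p ⟨0, Nat.pos_of_ne_zero hN⟩) h
    simp [ones] at this
  obtain ⟨φ, hφu, hφ1⟩ := SeparatingDual.exists_eq_one_ne_zero_of_ne_zero_pair (R := ℝ) hu h1
  obtain ⟨g, hg, hgu⟩ := exists_transvection (w := (φ (ones N))⁻¹ • ones N) hφu
    (by simp [hφ1])
  have hg0 : g 0 = 0 := by simpa using hgu 0
  have hgi : g '' ((fun a : ℝ => a • u) '' Icc 0 l) =
      (fun a : ℝ => a • (φ (ones N))⁻¹ • ones N) '' Icc 0 l := by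
    rw [image_image]; simp only [hgu]
  rcases lt_or_gt_of_ne (inv_ne_zero hφ1) with hneg | hpos
  · have hc := neg_pos.2 hneg
    set c := -(φ (ones N))⁻¹ with hcdef
    have hgi' : g '' ((fun a : ℝ => a • u) '' Icc 0 l) =
        (fun a : ℝ => a • (-ones N)) '' Icc 0 (l * c) := by
      rw [hgi, ← image_smul_Icc_eq hc]
      simp [hcdef]
    have hlc := mul_pos hl hc
    by_cases h2 : 2 ≤ N
    · obtain ⟨f, hf, hfu⟩ := exists_flip h2
      refine ⟨f ∘ g, l * c, hf.comp hg, hlc, ?_, fun _ => ?_⟩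
      · rw [image_comp, hgi', diagonalSegment_eq_image N hlc, image_image]
        refine image_congr fun a _ => ?_
        rw [smul_neg, ← neg_smul, hfu]
        simp
      · have := hfu 0
        simp only [zero_smul] at this
        simp [hg0, this]
    -- In dimension one the direction cannot be reversed, so the segment is translated onto the
    -- positive side and its start goes to the far end.
    · refine ⟨_, l * c, (isotopicToId_add_const ((l * c) • ones N)).comp hg, hlc, ?_,
        fun h => absurd h h2⟩
      rw [image_comp, hgi', diagonalSegment_eq_image N hlc, image_image]
      have : Icc 0 (l * c) = (fun a => l * c - a) '' Icc 0 (l * c) := by simp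
      conv_rhs => rw [this, image_image]
      refine image_congr fun a _ => ?_
      module
  · exact ⟨g, _, hg, mul_pos hl hpos, by
      rw [hgi, diagonalSegment_eq_image N (mul_pos hl hpos), image_smul_Icc_eq hpos],
      fun _ => hg0⟩

theorem exists_isotopy_to_diagonal {P : Phase N → Phase N} {x₀ : Phase N} {T : ℝ}
    {x : ℝ → Phase N} (hT : 0 < T) (hx : IsSolution P x₀ T x) (hP : ContinuousOn P (orbit T x))
    (hsimple : IsSimpleCurve T x) (hequil : ∀ p ∈ orbit T x, ¬ IsEquilibrium P p) (hN : N ≠ 0) :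
    ∃ (h : Phase N → Phase N) (c : ℝ), IsotopicToId h ∧ 0 < c ∧
      h '' orbit T x = diagonalSegment N c ∧ (2 ≤ N → h x₀ = 0) := by
  obtain ⟨S, u, m, δ, hSi, hu, hδ, hmc, hm, hSx⟩ :=
    exists_straightening hx hP hequil (left_mem_Icc.2 hT.le)
  set d := min δ T with hd
  have hd0 : 0 < d := lt_min hδ hT
  have hsub : Icc 0 d ⊆ Icc (0 - δ) (0 + δ) ∩ Icc 0 T := fun t ht =>
    ⟨⟨by linarith [ht.1], by linarith [ht.2.trans (min_le_left δ T)]⟩, ht.1,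
      ht.2.trans (min_le_right δ T)⟩
  have h0 : (0 : ℝ) ∈ Icc 0 d := left_mem_Icc.2 hd0.le
  have hl : 0 < m d - m 0 := sub_pos.2 (hm (hsub h0) (hsub (right_mem_Icc.2 hd0.le)) hd0)
  obtain ⟨g, hg, hg0, hgx⟩ := arcTransfer_of_isSolution hx hP hsimple hequil
    (right_mem_Ioc.2 hT) (t := d) ⟨hd0, min_le_right δ T⟩
  obtain ⟨f, c, hf, hc, hfu, hf0⟩ := exists_segment_to_diagonal hN hu hl
  refine ⟨f ∘ (fun p => p + (-m 0) • u) ∘ S ∘ g, c,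
    hf.comp ((isotopicToId_add_const _).comp (hSi.comp hg)), hc, ?_, fun h2 => ?_⟩
  · rw [← hfu, orbit, image_comp, image_comp, image_comp, hgx,
      image_image_Icc_of_straight hd0.le (hmc.mono (hsub.trans inter_subset_right))
        (hm.mono hsub) (fun r hr => hSx r (hsub hr)), image_image _ _ (Icc _ _)]
    have : Icc 0 (m d - m 0) = (fun a => a + -m 0) '' Icc (m 0) (m d) := by
      simp [sub_eq_add_neg]
    rw [this]
    simp only [image_image, add_smul]
  · rw [← hf0 h2, ← hx.initial]
    simp only [Function.comp_apply, hg0, hSx 0 (hsub h0)]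
    congr 1
    module

end OrbitIsotopy


theorem mainTheorem5 {N : ℕ} (P : OrbitIsotopy.Phase N → OrbitIsotopy.Phase N)
    (x₀ : OrbitIsotopy.Phase N) (T : ℝ) (hT : 0 < T) (x : ℝ → OrbitIsotopy.Phase N)
    (hx : OrbitIsotopy.IsSolution P x₀ T x)
    (hP : ContinuousOn P (OrbitIsotopy.orbit T x))
    (hsimple : OrbitIsotopy.IsSimpleCurve T x)
    (hequil : ∀ p ∈ OrbitIsotopy.orbit T x, ¬ OrbitIsotopy.IsEquilibrium P p) :
    ∃ (H : OrbitIsotopy.Phase N × unitInterval → OrbitIsotopy.Phase N) (c : ℝ),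
      OrbitIsotopy.IsAmbientIsotopy H ∧
      0 < c ∧
      OrbitIsotopy.Carries H (OrbitIsotopy.orbit T x) (OrbitIsotopy.diagonalSegment N c) ∧
      (∀ i : Fin N,
        StrictMonoOn (fun t : ℝ => H (x t, 1) i) (Set.Icc 0 T) ∨
        StrictAntiOn (fun t : ℝ => H (x t, 1) i) (Set.Icc 0 T)) ∧
      (2 ≤ N → H (x₀, 1) = 0 ∧
        ∀ i : Fin N, StrictMonoOn (fun t : ℝ => H (x t, 1) i) (Set.Icc 0 T)) := by
  -- In dimension zero the only point would be an equilibrium.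
  have hN : N ≠ 0 := by
    rintro rfl
    exact hequil (x 0) ⟨0, ⟨le_rfl, hT.le⟩, rfl⟩ (Subsingleton.elim _ _)
  obtain ⟨h, c, hi, hc, hcar, h0⟩ :=
    OrbitIsotopy.exists_isotopy_to_diagonal hT hx hP hsimple hequil hN
  have hxc : ContinuousOn x (Set.Icc 0 T) := fun t ht => (hx.hasDeriv t ht).continuousWithinAt
  have hdiag : ∀ t ∈ Set.Icc 0 T, ∃ a : ℝ, 0 ≤ a ∧ ∀ i, h (x t) i = a := fun t ht => by
    have : h (x t) ∈ OrbitIsotopy.diagonalSegment N c :=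
      hcar ▸ Set.mem_image_of_mem h (Set.mem_image_of_mem x ht)
    rw [OrbitIsotopy.diagonalSegment_eq_image N hc] at this
    obtain ⟨a, ha, hax⟩ := this
    exact ⟨a, ha.1, fun i => by simp [← hax, OrbitIsotopy.ones]⟩
  have hcont : ∀ i, ContinuousOn (fun t => h (x t) i) (Set.Icc 0 T) := fun i =>
    (EuclideanSpace.proj (𝕜 := ℝ) i).continuous.comp_continuousOn
      (hi.isHomeomorph.continuous.comp_continuousOn hxc)
  -- On the diagonal one coordinate determines the point.
  have hinj : ∀ i, Set.InjOn (fun t => h (x t) i) (Set.Icc 0 T) := fun i s hs t ht hst => by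
    obtain ⟨a, -, ha⟩ := hdiag s hs
    obtain ⟨b, -, hb⟩ := hdiag t ht
    refine hsimple hs ht (hi.isHomeomorph.injective ?_)
    ext j
    simp only [ha, hb] at hst ⊢
    exact hst
  obtain ⟨H, hH, hH1⟩ := hi
  refine ⟨H, c, hH, hc, ?_, ?_, fun h2 => ⟨?_, fun i => ?_⟩⟩
  · simpa only [OrbitIsotopy.Carries, hH1] using hcar
  · simp only [hH1]
    exact fun i => (hcont i).strictMonoOn_of_injOn_Icc' hT.le (hinj i)
  · rw [hH1, h0 h2]
  · simp only [hH1]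
    refine (hcont i).strictMonoOn_of_injOn_Icc hT.le ?_ (hinj i)
    obtain ⟨a, ha, hia⟩ := hdiag T (Set.right_mem_Icc.2 hT.le)
    rw [hx.initial, h0 h2, hia]
    exact ha
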